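/- Let $\mathcal E$ be a locally cartesian closed category with finite limits, and let $\mathbb A$ be an internal category in $\mathcal E$. Then $\mathbb A$ is (strongly) complete if and only if it is (strongly) cocomplete. Here, for an object $I$ of a category $\mathcal C$ with finite limits, $I^*\colon \mathcal C\to\mathcal C/I$ is the pullback functor $X\mapsto (I\times X\to I)$; it preserves finite limits and hence acts on internal categories, internal functors and internal natural transformations. A \emph{diagram} in an internal category $\mathbb B$ in $\mathcal C$ is an internal functor $D\colon\mathbb D\to\mathbb B$ from an arbitrary internal category $\mathbb D$ in $\mathcal C$. A \emph{cone} over $D$ consists of a vertex $V\colon 1\to\mathbb B$ and an internal natural transformation from the constant functor $\mathbb D\to 1\xrightarrow{V}\mathbb B$ to $D$; a morphism of cones $(V,\gamma)\to(V',\gamma')$ is a natural transformation $V\to V'$ (a global arrow of $\mathbb B$) whose composite with $\gamma'$ is $\gamma$. Cocones and their morphisms are defined dually. A cone $(V,\gamma)$ over $D$ is \emph{universal} if for every object $I$ of $\mathcal C$ the cone $I^*(V,\gamma)$ is a terminal object of the category of cones over $I^*D$ (internal to $\mathcal C/I$); a cocone is \emph{universal} if for every $I$ the cocone $I^*(V,\gamma)$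 is an initial object of the category of cocones over $I^*D$. The diagram $D$ \emph{admits a limit} (\emph{colimit}) if it has a universal cone (cocone). The internal category $\mathbb A$ is \emph{complete} (\emph{cocomplete}) if, for every object $I$ of $\mathcal E$, every diagram in $I^*\mathbb A$, of shape any internal category in $\mathcal E/I$, admits a limit (colimit). -/

import Mathlib

open CategoryTheory Limits

universe v u v' u'

/-- A category with finite limits is locally cartesian closed if every slice `Over I`, with its
cartesian monoidal structure given by pullbacks over `I`, is cartesian closed. -/
class LocallyCartesianClosed (E : Type u) [Category.{v} E] [HasFiniteLimits E] : Prop where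
  closed_over : ∀ I : E, Nonempty
    (@MonoidalClosed (Over I) _ (Over.cartesianMonoidalCategory I).toMonoidalCategory)

/-- The data of an internal category in `C`, together with the axioms on sources and targets.
The domain of `comp` is the object of pairs `(g, f)` of arrows with `src g = tgt f`. -/
structure PreInternalCategory (C : Type u) [Category.{v} C] [HasFiniteLimits C] where
  /-- the object of objects -/
  obj : C
  /-- the object of arrows -/
  arr : C
  /-- source -/
  src : arr ⟶ obj
  /-- target -/
  tgt : arr ⟶ obj
  /-- identities -/
  ident : obj ⟶ arr
  /-- composition -/
  comp : pullback src tgt ⟶ arr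
  ident_src : ident ≫ src = 𝟙 obj
  ident_tgt : ident ≫ tgt = 𝟙 obj
  comp_src : comp ≫ src = pullback.snd src tgt ≫ src
  comp_tgt : comp ≫ tgt = pullback.fst src tgt ≫ tgt

namespace PreInternalCategory

variable {C : Type u} [Category.{v} C] [HasFiniteLimits C] (A : PreInternalCategory C)

/-- The composite `g ∘ f` of two generalized elements `g, f : X ⟶ A.arr` of the object of arrows
(terms of type `A.arr` in context `X`) such that the source of `g` is the target of `f`. -/
noncomputable def compose {X : C} (g f : X ⟶ A.arr) (h : g ≫ A.src = f ≫ A.tgt) : X ⟶ A.arr :=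
  pullback.lift g f h ≫ A.comp

theorem compose_src {X : C} (g f : X ⟶ A.arr) (h : g ≫ A.src = f ≫ A.tgt) :
    A.compose g f h ≫ A.src = f ≫ A.src := by
  rw [compose, Category.assoc, A.comp_src, pullback.lift_snd_assoc]

theorem compose_tgt {X : C} (g f : X ⟶ A.arr) (h : g ≫ A.src = f ≫ A.tgt) :
    A.compose g f h ≫ A.tgt = g ≫ A.tgt := by
  rw [compose, Category.assoc, A.comp_tgt, pullback.lift_fst_assoc]

theorem comp_compose {X Y : C} (u : Y ⟶ X) (g f : X ⟶ A.arr) (h : g ≫ A.src = f ≫ A.tgt) :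
    u ≫ A.compose g f h = A.compose (u ≫ g) (u ≫ f) (by simp [h]) := by
  have e : u ≫ pullback.lift g f h = pullback.lift (u ≫ g) (u ≫ f) (by simp [h]) := by
    apply pullback.hom_ext <;> simp [pullback.lift_fst, pullback.lift_snd]
  simp only [compose, ← e, Category.assoc]

theorem compose_congr {X : C} {g g' f f' : X ⟶ A.arr} (hg : g = g') (hf : f = f')
    (h : g ≫ A.src = f ≫ A.tgt) :
    A.compose g f h = A.compose g' f' (by rw [← hg, ← hf, h]) := by
  subst hg hf; rfl

end PreInternalCategory

/-- An internal category in `C`. The associativity and unit axioms are stated in the internal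
language, that is, for generalized elements. -/
structure InternalCategory (C : Type u) [Category.{v} C] [HasFiniteLimits C] extends
    PreInternalCategory C where
  assoc : ∀ {X : C} (h g f : X ⟶ arr) (hg : h ≫ src = g ≫ tgt) (gf : g ≫ src = f ≫ tgt),
    toPreInternalCategory.compose h (toPreInternalCategory.compose g f gf)
        (by rw [hg, PreInternalCategory.compose_tgt]) =
      toPreInternalCategory.compose (toPreInternalCategory.compose h g hg) f
        (by rw [← gf, PreInternalCategory.compose_src])
  comp_ident : ∀ {X : C} (f : X ⟶ arr),
    toPreInternalCategory.compose f ((f ≫ src) ≫ ident)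
      (by rw [Category.assoc, ident_tgt, Category.comp_id]) = f
  ident_comp : ∀ {X : C} (f : X ⟶ arr),
    toPreInternalCategory.compose ((f ≫ tgt) ≫ ident) f
      (by rw [Category.assoc, ident_src, Category.comp_id]) = f

/-- An internal functor. -/
structure InternalFunctor {C : Type u} [Category.{v} C] [HasFiniteLimits C]
    (A B : InternalCategory C) where
  /-- the action on objects -/
  onObj : A.obj ⟶ B.obj
  /-- the action on arrows -/
  onArr : A.arr ⟶ B.arr
  map_src : onArr ≫ B.src = A.src ≫ onObj
  map_tgt : onArr ≫ B.tgt = A.tgt ≫ onObj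
  map_ident : A.ident ≫ onArr = onObj ≫ B.ident
  map_comp : ∀ {X : C} (g f : X ⟶ A.arr) (h : g ≫ A.src = f ≫ A.tgt),
    A.compose g f h ≫ onArr = B.compose (g ≫ onArr) (f ≫ onArr)
      (by rw [Category.assoc, Category.assoc, map_src, map_tgt, reassoc_of% h])

/-- An internal natural transformation `F ⟶ G`. -/
structure InternalNatTrans {C : Type u} [Category.{v} C] [HasFiniteLimits C]
    {A B : InternalCategory C} (F G : InternalFunctor A B) where
  /-- the family of components -/
  app : A.obj ⟶ B.arr
  app_src : app ≫ B.src = F.onObj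
  app_tgt : app ≫ B.tgt = G.onObj
  naturality :
    B.compose (A.tgt ≫ app) F.onArr (by rw [Category.assoc, app_src, F.map_tgt]) =
      B.compose G.onArr (A.src ≫ app) (by rw [Category.assoc, app_tgt, G.map_src])

section Cones

variable {C : Type u} [Category.{v} C] [HasFiniteLimits C]

/-- The constant functor at a global object `a : ⊤_ C ⟶ A.obj` of `A`, that is, the composite
`𝔻 ⟶ 1 ⟶ A` of internal functors. -/
noncomputable def InternalFunctor.const (𝔻 : InternalCategory C) {A : InternalCategory C}
    (a : ⊤_ C ⟶ A.obj) : InternalFunctor 𝔻 A where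
  onObj := terminal.from _ ≫ a
  onArr := terminal.from _ ≫ a ≫ A.ident
  map_src := by
    rw [Category.assoc, Category.assoc, A.ident_src, Category.comp_id, ← Category.assoc]
    congr 1; exact Subsingleton.elim _ _
  map_tgt := by
    rw [Category.assoc, Category.assoc, A.ident_tgt, Category.comp_id, ← Category.assoc]
    congr 1; exact Subsingleton.elim _ _
  map_ident := by simp [← Category.assoc]
  map_comp {X} g f h := by
    have e : A.compose (terminal.from X ≫ a ≫ A.ident)
        (((terminal.from X ≫ a ≫ A.ident) ≫ A.src) ≫ A.ident) (by simp [A.ident_tgt]) =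
          terminal.from X ≫ a ≫ A.ident := A.comp_ident _
    have e1 : ((terminal.from X ≫ a ≫ A.ident) ≫ A.src) ≫ A.ident =
        terminal.from X ≫ a ≫ A.ident := by simp [A.ident_src]
    rw [A.compose_congr rfl e1] at e
    have eg (k : X ⟶ 𝔻.arr) : k ≫ terminal.from _ ≫ a ≫ A.ident =
        terminal.from X ≫ a ≫ A.ident := by simp [← Category.assoc]
    rw [eg, A.compose_congr (eg g) (eg f)]
    exact e.symm

variable {𝔻 A : InternalCategory C}

/-- A cone over a diagram `D : 𝔻 ⟶ A`: a vertex, which is a global object of `A`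
(an internal functor `1 ⟶ A`), with a natural transformation from the constant functor to `D`. -/
structure InternalCone (D : InternalFunctor 𝔻 A) where
  /-- the vertex -/
  vertex : ⊤_ C ⟶ A.obj
  /-- the legs -/
  legs : InternalNatTrans (InternalFunctor.const 𝔻 vertex) D

/-- A cocone over a diagram `D : 𝔻 ⟶ A`: a vertex, which is a global object of `A`,
with a natural transformation from `D` to the constant functor. -/
structure InternalCocone (D : InternalFunctor 𝔻 A) where
  /-- the vertex -/
  vertex : ⊤_ C ⟶ A.obj
  /-- the legs -/
  legs : InternalNatTrans D (InternalFunctor.const 𝔻 vertex)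

/-- A morphism of cones: a global arrow of `A` between the vertices commuting with the legs. -/
@[ext]
structure InternalCone.Hom {D : InternalFunctor 𝔻 A} (c c' : InternalCone D) where
  /-- the arrow between the vertices -/
  hom : ⊤_ C ⟶ A.arr
  hom_src : hom ≫ A.src = c.vertex
  hom_tgt : hom ≫ A.tgt = c'.vertex
  w : A.compose c'.legs.app (terminal.from 𝔻.obj ≫ hom)
    (by rw [c'.legs.app_src, Category.assoc, hom_tgt]; rfl) = c.legs.app

/-- A morphism of cocones: a global arrow of `A` between the vertices commuting with the legs. -/
@[ext]
structure InternalCocone.Hom {D : InternalFunctor 𝔻 A} (c c' : InternalCocone D) where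
  /-- the arrow between the vertices -/
  hom : ⊤_ C ⟶ A.arr
  hom_src : hom ≫ A.src = c.vertex
  hom_tgt : hom ≫ A.tgt = c'.vertex
  w : A.compose (terminal.from 𝔻.obj ≫ hom) c.legs.app
    (by rw [c.legs.app_tgt, Category.assoc, hom_src]; rfl) = c'.legs.app

namespace InternalCategory

theorem compose_ident' (A : InternalCategory C) {X : C} (f : X ⟶ A.arr) (a : X ⟶ A.obj)
    (h : f ≫ A.src = a) : A.compose f (a ≫ A.ident) (by simp [A.ident_tgt, h]) = f := by
  subst h; exact A.comp_ident f

theorem ident_compose' (A : InternalCategory C) {X : C} (f : X ⟶ A.arr) (a : X ⟶ A.obj)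
    (h : f ≫ A.tgt = a) : A.compose (a ≫ A.ident) f (by simp [A.ident_src, h]) = f := by
  subst h; exact A.ident_comp f

end InternalCategory

/-- The (external) category of cones over a diagram. -/
noncomputable instance (D : InternalFunctor 𝔻 A) : Category (InternalCone D) where
  Hom c c' := InternalCone.Hom c c'
  id c :=
    { hom := c.vertex ≫ A.ident
      hom_src := by simp [A.ident_src]
      hom_tgt := by simp [A.ident_tgt]
      w := by
        rw [A.compose_congr rfl (Category.assoc _ _ _).symm]
        exact A.compose_ident' _ _ c.legs.app_src }
  comp {c c' c''} k l :=
    { hom := A.compose l.hom k.hom (by rw [l.hom_src, k.hom_tgt])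
      hom_src := by rw [A.compose_src, k.hom_src]
      hom_tgt := by rw [A.compose_tgt, l.hom_tgt]
      w := by
        rw [A.compose_congr rfl (A.comp_compose _ _ _ _), A.assoc,
          A.compose_congr l.w rfl, k.w]
        · rw [c''.legs.app_src, Category.assoc, l.hom_tgt]; rfl }
  id_comp {c c'} k := InternalCone.Hom.ext (A.compose_ident' _ _ k.hom_src)
  comp_id {c c'} k := InternalCone.Hom.ext (A.ident_compose' _ _ k.hom_tgt)
  assoc {c c' c'' c'''} k l m := InternalCone.Hom.ext (A.assoc _ _ _
    (by rw [m.hom_src, l.hom_tgt]) (by rw [l.hom_src, k.hom_tgt]))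

/-- The (external) category of cocones over a diagram. -/
noncomputable instance (D : InternalFunctor 𝔻 A) : Category (InternalCocone D) where
  Hom c c' := InternalCocone.Hom c c'
  id c :=
    { hom := c.vertex ≫ A.ident
      hom_src := by simp [A.ident_src]
      hom_tgt := by simp [A.ident_tgt]
      w := by
        rw [A.compose_congr (Category.assoc _ _ _).symm rfl]
        exact A.ident_compose' _ _ c.legs.app_tgt }
  comp {c c' c''} k l :=
    { hom := A.compose l.hom k.hom (by rw [l.hom_src, k.hom_tgt])
      hom_src := by rw [A.compose_src, k.hom_src]
      hom_tgt := by rw [A.compose_tgt, l.hom_tgt]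
      w := by
        rw [A.compose_congr (A.comp_compose _ _ _ _) rfl, ← A.assoc,
          A.compose_congr rfl k.w, l.w]
        · rw [c.legs.app_tgt, Category.assoc, k.hom_src]; rfl }
  id_comp {c c'} k := InternalCocone.Hom.ext (A.compose_ident' _ _ k.hom_src)
  comp_id {c c'} k := InternalCocone.Hom.ext (A.ident_compose' _ _ k.hom_tgt)
  assoc {c c' c'' c'''} k l m := InternalCocone.Hom.ext (A.assoc _ _ _
    (by rw [m.hom_src, l.hom_tgt]) (by rw [l.hom_src, k.hom_tgt]))

end Cones

/-! Functors preserving finite limits act on internal categories, functors and (co)cones. -/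

section Map

variable {C : Type u} [Category.{v} C] [HasFiniteLimits C]
  {C' : Type u'} [Category.{v'} C'] [HasFiniteLimits C']
  (F : C ⥤ C') [PreservesFiniteLimits F]

/-- The image of the data of an internal category under a functor `F` preserving finite limits.
Composition is the image of composition, up to the canonical isomorphism between
`F (A₁ ×_{A₀} A₁)` and `F A₁ ×_{F A₀} F A₁`. -/
noncomputable abbrev PreInternalCategory.map (A : PreInternalCategory C) :
    PreInternalCategory C' where
  obj := F.obj A.obj
  arr := F.obj A.arr
  src := F.map A.src
  tgt := F.map A.tgt
  ident := F.map A.ident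
  comp := (PreservesPullback.iso F A.src A.tgt).inv ≫ F.map A.comp
  ident_src := by rw [← F.map_comp, A.ident_src, F.map_id]
  ident_tgt := by rw [← F.map_comp, A.ident_tgt, F.map_id]
  comp_src := by
    rw [Category.assoc, ← F.map_comp, A.comp_src, F.map_comp]
    simp
  comp_tgt := by
    rw [Category.assoc, ← F.map_comp, A.comp_tgt, F.map_comp]
    simp

theorem PreInternalCategory.map_compose (A : PreInternalCategory C) {X : C'} {Y : C}
    (u : X ⟶ F.obj Y) (g f : Y ⟶ A.arr) (h : g ≫ A.src = f ≫ A.tgt) {g' f' : X ⟶ (A.map F).arr}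
    (hg : g' = u ≫ F.map g) (hf : f' = u ≫ F.map f)
    (h' : g' ≫ (A.map F).src = f' ≫ (A.map F).tgt) :
    (A.map F).compose g' f' h' = u ≫ F.map (A.compose g f h) := by
  subst hg hf
  have h'' : (u ≫ F.map g) ≫ F.map A.src = (u ≫ F.map f) ≫ F.map A.tgt := h'
  have e : pullback.lift (u ≫ F.map g) (u ≫ F.map f) h'' = u ≫ F.map (pullback.lift g f h) ≫
        (PreservesPullback.iso F A.src A.tgt).hom := by
    apply pullback.hom_ext
    · rw [pullback.lift_fst, Category.assoc, Category.assoc, PreservesPullback.iso_hom_fst,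
        ← F.map_comp, pullback.lift_fst]
    · rw [pullback.lift_snd, Category.assoc, Category.assoc, PreservesPullback.iso_hom_snd,
        ← F.map_comp, pullback.lift_snd]
  change pullback.lift (u ≫ F.map g) (u ≫ F.map f) h'' ≫
    (PreservesPullback.iso F A.src A.tgt).inv ≫ F.map A.comp = u ≫ F.map (_ ≫ _)
  rw [e, Category.assoc, Category.assoc, Iso.hom_inv_id_assoc, F.map_comp]

theorem PreInternalCategory.exists_pair (A : PreInternalCategory C) {X : C'}
    (g f : X ⟶ F.obj A.arr) (h : g ≫ F.map A.src = f ≫ F.map A.tgt) :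
    ∃ u : X ⟶ F.obj (pullback A.src A.tgt),
      g = u ≫ F.map (pullback.fst A.src A.tgt) ∧ f = u ≫ F.map (pullback.snd A.src A.tgt) :=
  ⟨pullback.lift g f h ≫ (PreservesPullback.iso F A.src A.tgt).inv, by simp [pullback.lift_fst],
    by simp [pullback.lift_snd]⟩

theorem PreInternalCategory.exists_triple (A : PreInternalCategory C) {X : C'}
    (h g f : X ⟶ F.obj A.arr) (hg : h ≫ F.map A.src = g ≫ F.map A.tgt)
    (gf : g ≫ F.map A.src = f ≫ F.map A.tgt) :
    ∃ (Y : C) (u : X ⟶ F.obj Y) (h' g' f' : Y ⟶ A.arr), h' ≫ A.src = g' ≫ A.tgt ∧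
      g' ≫ A.src = f' ≫ A.tgt ∧ h = u ≫ F.map h' ∧ g = u ≫ F.map g' ∧ f = u ≫ F.map f' := by
  obtain ⟨w, hw1, hw2⟩ := A.exists_pair F h g hg
  have e : w ≫ F.map (pullback.snd A.src A.tgt ≫ A.src) = f ≫ F.map A.tgt := by
    rw [F.map_comp, ← Category.assoc, ← hw2, gf]
  refine ⟨pullback (pullback.snd A.src A.tgt ≫ A.src) A.tgt,
    pullback.lift w f e ≫ (PreservesPullback.iso F _ _).inv,
    pullback.fst _ _ ≫ pullback.fst _ _, pullback.fst _ _ ≫ pullback.snd _ _, pullback.snd _ _,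
    ?_, ?_, ?_, ?_, ?_⟩
  · rw [Category.assoc, Category.assoc, pullback.condition]
  · rw [Category.assoc, pullback.condition]
  · rw [Category.assoc, F.map_comp (pullback.fst (pullback.snd A.src A.tgt ≫ A.src) A.tgt),
      PreservesPullback.iso_inv_fst_assoc, pullback.lift_fst_assoc, hw1]
  · rw [Category.assoc, F.map_comp (pullback.fst (pullback.snd A.src A.tgt ≫ A.src) A.tgt),
      PreservesPullback.iso_inv_fst_assoc, pullback.lift_fst_assoc, hw2]
  · rw [Category.assoc, PreservesPullback.iso_inv_snd, pullback.lift_snd]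

/-- The image of an internal category under a functor preserving finite limits. -/
noncomputable abbrev InternalCategory.map (A : InternalCategory C) : InternalCategory C' where
  toPreInternalCategory := A.toPreInternalCategory.map F
  assoc {X} h g f hg gf := by
    obtain ⟨Y, u, h', g', f', hg', gf', e1, e2, e3⟩ := A.exists_triple F h g f hg gf
    rw [A.map_compose F u h' (A.compose g' f' gf') (by rw [hg', A.compose_tgt]) e1
        (A.map_compose F u g' f' gf' e2 e3 gf),
      A.map_compose F u (A.compose h' g' hg') f' (by rw [← gf', A.compose_src])
        (A.map_compose F u h' g' hg' e1 e2 hg) e3, A.assoc]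
  comp_ident {X} f :=
    (A.map_compose F f (𝟙 _) ((𝟙 _ ≫ A.src) ≫ A.ident) (by simp [A.ident_tgt])
      (by rw [F.map_id, Category.comp_id])
      (by rw [Category.id_comp, F.map_comp]; exact Category.assoc _ _ _) _).trans
      (by rw [A.comp_ident, F.map_id, Category.comp_id])
  ident_comp {X} f :=
    (A.map_compose F f ((𝟙 _ ≫ A.tgt) ≫ A.ident) (𝟙 _) (by simp [A.ident_src])
      (by rw [Category.id_comp, F.map_comp]; exact Category.assoc _ _ _)
      (by rw [F.map_id, Category.comp_id]) _).trans
      (by rw [A.ident_comp, F.map_id, Category.comp_id])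

variable {𝔻 A : InternalCategory C}

/-- The image of an internal functor under a functor preserving finite limits. -/
noncomputable abbrev InternalFunctor.map (D : InternalFunctor 𝔻 A) :
    InternalFunctor (𝔻.map F) (A.map F) where
  onObj := F.map D.onObj
  onArr := F.map D.onArr
  map_src := (F.map_comp _ _).symm.trans ((congrArg F.map D.map_src).trans (F.map_comp _ _))
  map_tgt := (F.map_comp _ _).symm.trans ((congrArg F.map D.map_tgt).trans (F.map_comp _ _))
  map_ident := (F.map_comp _ _).symm.trans ((congrArg F.map D.map_ident).trans (F.map_comp _ _))
  map_comp {X} g f h := by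
    obtain ⟨u, hg, hf⟩ := 𝔻.exists_pair F g f h
    have e (k : pullback 𝔻.src 𝔻.tgt ⟶ 𝔻.arr) (k' : X ⟶ F.obj 𝔻.arr) (hk : k' = u ≫ F.map k) :
        k' ≫ F.map D.onArr = u ≫ F.map (k ≫ D.onArr) := by
      rw [hk, F.map_comp, Category.assoc]
    rw [𝔻.map_compose F u _ _ pullback.condition hg hf h]
    rw [A.map_compose F u _ _ (by rw [Category.assoc, Category.assoc, D.map_src, D.map_tgt,
      reassoc_of% (pullback.condition (f := 𝔻.src) (g := 𝔻.tgt))]) (e _ g hg) (e _ f hf), ← D.map_comp _ _ pullback.condition]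
    exact (e _ _ rfl)

theorem InternalFunctor.map_const_aux (a : ⊤_ C ⟶ A.obj) (X : C) :
    F.map (terminal.from X ≫ a) =
      terminal.from (F.obj X) ≫ (PreservesTerminal.iso F).inv ≫ F.map a := by
  rw [F.map_comp, ← Category.assoc (terminal.from (F.obj X))]
  congr 1
  rw [Iso.eq_comp_inv]
  exact Subsingleton.elim _ _

theorem InternalFunctor.map_const (𝔻 : InternalCategory C) (a : ⊤_ C ⟶ A.obj) :
    (InternalFunctor.const 𝔻 a).map F =
      InternalFunctor.const (𝔻.map F) ((PreservesTerminal.iso F).inv ≫ F.map a) := by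
  have h0 := InternalFunctor.map_const_aux F a 𝔻.obj
  have h1 : F.map (terminal.from 𝔻.arr ≫ a ≫ A.ident) = terminal.from (F.obj 𝔻.arr) ≫
      ((PreservesTerminal.iso F).inv ≫ F.map a) ≫ F.map A.ident := by
    rw [← Category.assoc, F.map_comp, InternalFunctor.map_const_aux]
    simp only [Category.assoc]
  have ext {B B' : InternalCategory C'} {G G' : InternalFunctor B B'} (e0 : G.onObj = G'.onObj)
      (e1 : G.onArr = G'.onArr) : G = G' := by
    cases G; cases G'; cases e0; cases e1; rfl
  exact ext h0 h1

/-- The image of an internal natural transformation under a functor preserving finite limits. -/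
noncomputable def InternalNatTrans.map {G H : InternalFunctor 𝔻 A} (α : InternalNatTrans G H) :
    InternalNatTrans (G.map F) (H.map F) where
  app := F.map α.app
  app_src := (F.map_comp _ _).symm.trans (congrArg F.map α.app_src)
  app_tgt := (F.map_comp _ _).symm.trans (congrArg F.map α.app_tgt)
  naturality := by
    rw [A.map_compose F (𝟙 _) (𝔻.tgt ≫ α.app) G.onArr
        (by rw [Category.assoc, α.app_src, G.map_tgt])
        (by rw [Category.id_comp]; exact (F.map_comp _ _).symm)
        (by rw [Category.id_comp]), α.naturality]
    exact (A.map_compose F (𝟙 _) H.onArr (𝔻.src ≫ α.app)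
        (by rw [Category.assoc, α.app_tgt, H.map_src])
        (by rw [Category.id_comp])
        (by rw [Category.id_comp]; exact (F.map_comp _ _).symm) _).symm

/-- Transport of the source and target of a natural transformation along equalities; the
components do not change. -/
def InternalNatTrans.copy {G G' H H' : InternalFunctor 𝔻 A} (α : InternalNatTrans G H)
    (hG : G = G') (hH : H = H') : InternalNatTrans G' H' where
  app := α.app
  app_src := by rw [α.app_src, hG]
  app_tgt := by rw [α.app_tgt, hH]
  naturality := by subst hG hH; exact α.naturality

/-- The image of a cone under a functor `F` preserving finite limits; the vertex is transported
along the canonical isomorphism `⊤_ C' ≅ F.obj (⊤_ C)`. -/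
noncomputable def InternalCone.map {D : InternalFunctor 𝔻 A} (c : InternalCone D) :
    InternalCone (D.map F) where
  vertex := (PreservesTerminal.iso F).inv ≫ F.map c.vertex
  legs := (c.legs.map F).copy (InternalFunctor.map_const F 𝔻 c.vertex) rfl

/-- The image of a cocone under a functor `F` preserving finite limits; the vertex is transported
along the canonical isomorphism `⊤_ C' ≅ F.obj (⊤_ C)`. -/
noncomputable def InternalCocone.map {D : InternalFunctor 𝔻 A} (c : InternalCocone D) :
    InternalCocone (D.map F) where
  vertex := (PreservesTerminal.iso F).inv ≫ F.map c.vertex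
  legs := (c.legs.map F).copy rfl (InternalFunctor.map_const F 𝔻 c.vertex)

end Map

/-! Base change along `I ⟶ 1`, universal cones and completeness. -/

section Complete

variable {C : Type u} [Category.{v} C] [HasFiniteLimits C]

/-- The base change functor `I^* : C ⥤ Over I`, `X ↦ (I × X ⟶ I)`, preserves finite limits. -/
instance (I : C) : PreservesFiniteLimits (Over.star I) :=
  have := (Over.forgetAdjStar I).rightAdjoint_preservesLimits
  PreservesLimits.preservesFiniteLimits _

/-- The internal category `I^* A` in `Over I`. -/
noncomputable abbrev InternalCategory.baseChange (A : InternalCategory C) (I : C) :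
    InternalCategory (Over I) :=
  A.map (Over.star I)

variable {𝔻 A : InternalCategory C}

/-- The diagram `I^* D` of shape `I^* 𝔻` in `I^* A`. -/
noncomputable abbrev InternalFunctor.baseChange (D : InternalFunctor 𝔻 A) (I : C) :
    InternalFunctor (𝔻.baseChange I) (A.baseChange I) :=
  D.map (Over.star I)

/-- The cone `I^* c` over `I^* D`. -/
noncomputable def InternalCone.baseChange {D : InternalFunctor 𝔻 A} (c : InternalCone D) (I : C) :
    InternalCone (D.baseChange I) :=
  c.map (Over.star I)

/-- The cocone `I^* c` over `I^* D`. -/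
noncomputable def InternalCocone.baseChange {D : InternalFunctor 𝔻 A} (c : InternalCocone D)
    (I : C) : InternalCocone (D.baseChange I) :=
  c.map (Over.star I)

/-- A cone over `D` is universal if, for every object `I`, the cone `I^* c` is terminal in the
category of cones over `I^* D`. -/
def InternalCone.IsUniversal {D : InternalFunctor 𝔻 A} (c : InternalCone D) : Prop :=
  ∀ I : C, Nonempty (IsTerminal (c.baseChange I))

/-- A cocone over `D` is universal if, for every object `I`, the cocone `I^* c` is initial in the
category of cocones over `I^* D`. -/
def InternalCocone.IsUniversal {D : InternalFunctor 𝔻 A} (c : InternalCocone D) : Prop :=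
  ∀ I : C, Nonempty (IsInitial (c.baseChange I))

/-- The diagram `D` has a limit: there is a universal cone over it. -/
def InternalFunctor.HasLimit (D : InternalFunctor 𝔻 A) : Prop :=
  ∃ c : InternalCone D, c.IsUniversal

/-- The diagram `D` has a colimit: there is a universal cocone over it. -/
def InternalFunctor.HasColimit (D : InternalFunctor 𝔻 A) : Prop :=
  ∃ c : InternalCocone D, c.IsUniversal

/-- An internal category `A` in `C` is (strongly) complete if, for every object `I` of `C`, every
diagram in `I^* A`, whose shape is any internal category in `Over I`, has a limit. -/
def InternalCategory.IsComplete (A : InternalCategory C) : Prop :=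
  ∀ (I : C) (𝔻 : InternalCategory (Over I)) (D : InternalFunctor 𝔻 (A.baseChange I)), D.HasLimit

/-- An internal category `A` in `C` is (strongly) cocomplete if, for every object `I` of `C`, every
diagram in `I^* A`, whose shape is any internal category in `Over I`, has a colimit. -/
def InternalCategory.IsCocomplete (A : InternalCategory C) : Prop :=
  ∀ (I : C) (𝔻 : InternalCategory (Over I)) (D : InternalFunctor 𝔻 (A.baseChange I)),
    D.HasColimit

end Complete

/-!
The proof is the internal version of the classical argument that a category with all limits has all
colimits: the colimit of `D` is the limit of the forgetful functor from the category of cocones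
under `D`. Internally there is no size obstruction, because the cocones under `D` are the objects
of an internal category.

By definition, completeness of `A` says that for every `I` all diagrams in `A.baseChange I` have
limits, so it suffices to work in one cartesian closed category with finite limits at a time,
namely `Over I`. There, the definition of universality quantifies over all base changes of a cone
along `J ⟶ 1`. By the adjunction `Over.forget J ⊣ Over.star J`, cones over `J^* D` are the same as
`J`-indexed families of cones over `D`, here called cones in context `J`; this gives the
reformulations `InternalCone.isUniversal_iff` and `InternalCocone.isUniversal_iff`, in which no
slice category is left.

Cartesian closedness is used once: it makes the presheaf of cocones under `D` representable
(`CoconeClassifier.nonempty`). The representing object is the object of objects of an internal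
category whose arrows are pairs of a cocone and an arrow of `A` out of its vertex, that is, the
category of elements of the functor sending `a` to the set of cocones with vertex `a`
(`CoconeClassifier.category`). Let `L` be a limit of its forgetful functor to `A`. For each object
`d` of the shape, the legs at `d` of all cocones form a cone, hence induce `D d ⟶ L`, and these
arrows form a cocone. A cocone `k` receives a morphism from it, the leg of the limit cone at `k`.
Since the leg at the cocone on `L` itself is the identity, naturality of the limit cone shows that
this morphism is the only one (`exists_universal_genCocone`).

The converse is the same statement for the opposite internal category
(`InternalFunctor.hasLimit_of_op`).
-/

/-! ### Cones and cocones in context -/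

section GeneralizedCones

variable {C : Type u} [Category.{v} C] [HasFiniteLimits C] {𝔻 A : InternalCategory C}

theorem InternalCone.legs_src {D : InternalFunctor 𝔻 A} (c : InternalCone D) :
    c.legs.app ≫ A.src = terminal.from _ ≫ c.vertex :=
  c.legs.app_src

theorem InternalCocone.legs_tgt {D : InternalFunctor 𝔻 A} (c : InternalCocone D) :
    c.legs.app ≫ A.tgt = terminal.from _ ≫ c.vertex :=
  c.legs.app_tgt

/-- Naturality of the legs of a cone, with the identity arrows of the constant functor removed. -/
theorem InternalCone.legs_naturality {D : InternalFunctor 𝔻 A} (c : InternalCone D) :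
    A.compose D.onArr (𝔻.src ≫ c.legs.app)
      (by rw [Category.assoc, c.legs.app_tgt, D.map_src]) = 𝔻.tgt ≫ c.legs.app := by
  rw [← c.legs.naturality]
  refine (A.compose_congr rfl (Category.assoc _ _ _).symm _).trans (A.compose_ident' _ _ ?_)
  simp [c.legs_src]

/-- Naturality of the legs of a cocone, with the identity arrows of the constant functor
removed. -/
theorem InternalCocone.legs_naturality {D : InternalFunctor 𝔻 A} (c : InternalCocone D) :
    A.compose (𝔻.tgt ≫ c.legs.app) D.onArr
      (by rw [Category.assoc, c.legs.app_src, D.map_tgt]) = 𝔻.src ≫ c.legs.app := by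
  rw [c.legs.naturality]
  refine (A.compose_congr (Category.assoc _ _ _).symm rfl _).trans (A.ident_compose' _ _ ?_)
  simp [c.legs_tgt]

/-- A cone over the family of diagrams that is constantly `D`, indexed by the object `J`, or in
other words a cone over `D` in context `J`. The leg at `d` of the member at `j` is given on all
generalized elements `(j, d)` of `J × 𝔻.obj`, so that no product has to be chosen. -/
structure GenCone (D : InternalFunctor 𝔻 A) (J : C) where
  /-- the family of vertices -/
  vertex : J ⟶ A.obj
  /-- the family of legs -/
  leg : ∀ {X : C}, (X ⟶ J) → (X ⟶ 𝔻.obj) → (X ⟶ A.arr)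
  comp_leg : ∀ {X Y : C} (u : Y ⟶ X) (j : X ⟶ J) (d : X ⟶ 𝔻.obj),
    u ≫ leg j d = leg (u ≫ j) (u ≫ d)
  leg_src : ∀ {X : C} (j : X ⟶ J) (d : X ⟶ 𝔻.obj), leg j d ≫ A.src = j ≫ vertex
  leg_tgt : ∀ {X : C} (j : X ⟶ J) (d : X ⟶ 𝔻.obj), leg j d ≫ A.tgt = d ≫ D.onObj
  naturality : ∀ {X : C} (j : X ⟶ J) (f : X ⟶ 𝔻.arr),
    A.compose (f ≫ D.onArr) (leg j (f ≫ 𝔻.src))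
      (by rw [leg_tgt, Category.assoc, Category.assoc, D.map_src]) = leg j (f ≫ 𝔻.tgt)

/-- A cocone under the family of diagrams that is constantly `D`, indexed by the object `J`, or in
other words a cocone under `D` in context `J`. -/
structure GenCocone (D : InternalFunctor 𝔻 A) (J : C) where
  /-- the family of vertices -/
  vertex : J ⟶ A.obj
  /-- the family of legs -/
  leg : ∀ {X : C}, (X ⟶ J) → (X ⟶ 𝔻.obj) → (X ⟶ A.arr)
  comp_leg : ∀ {X Y : C} (u : Y ⟶ X) (j : X ⟶ J) (d : X ⟶ 𝔻.obj),
    u ≫ leg j d = leg (u ≫ j) (u ≫ d)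
  leg_src : ∀ {X : C} (j : X ⟶ J) (d : X ⟶ 𝔻.obj), leg j d ≫ A.src = d ≫ D.onObj
  leg_tgt : ∀ {X : C} (j : X ⟶ J) (d : X ⟶ 𝔻.obj), leg j d ≫ A.tgt = j ≫ vertex
  naturality : ∀ {X : C} (j : X ⟶ J) (f : X ⟶ 𝔻.arr),
    A.compose (leg j (f ≫ 𝔻.tgt)) (f ≫ D.onArr)
      (by rw [leg_src, Category.assoc, Category.assoc, D.map_tgt]) = leg j (f ≫ 𝔻.src)

/-- `h` is a morphism from the cone `s` in context `J` to the global cone `c`. -/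
structure GenCone.IsHom {D : InternalFunctor 𝔻 A} {J : C} (s : GenCone D J) (c : InternalCone D)
    (h : J ⟶ A.arr) : Prop where
  src : h ≫ A.src = s.vertex
  tgt : h ≫ A.tgt = terminal.from J ≫ c.vertex
  fac : ∀ {X : C} (j : X ⟶ J) (d : X ⟶ 𝔻.obj), A.compose (d ≫ c.legs.app) (j ≫ h)
    (by simp [c.legs_src, tgt]) = s.leg j d

/-- `h` is a morphism from the global cocone `c` to the cocone `s` in context `J`. -/
structure GenCocone.IsHom {D : InternalFunctor 𝔻 A} {J : C} (s : GenCocone D J)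
    (c : InternalCocone D) (h : J ⟶ A.arr) : Prop where
  src : h ≫ A.src = terminal.from J ≫ c.vertex
  tgt : h ≫ A.tgt = s.vertex
  fac : ∀ {X : C} (j : X ⟶ J) (d : X ⟶ 𝔻.obj), A.compose (j ≫ h) (d ≫ c.legs.app)
    (by simp [c.legs_tgt, src]) = s.leg j d

/-- Reindexing of a cone in context along `u`. -/
def GenCone.reindex {D : InternalFunctor 𝔻 A} {J K : C} (s : GenCone D J) (u : K ⟶ J) :
    GenCone D K where
  vertex := u ≫ s.vertex
  leg k d := s.leg (k ≫ u) d
  comp_leg v k d := by rw [s.comp_leg, Category.assoc]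
  leg_src k d := by rw [s.leg_src, Category.assoc]
  leg_tgt k d := s.leg_tgt _ _
  naturality k f := s.naturality _ _

/-- Reindexing of a cocone in context along `u`. -/
def GenCocone.reindex {D : InternalFunctor 𝔻 A} {J K : C} (s : GenCocone D J) (u : K ⟶ J) :
    GenCocone D K where
  vertex := u ≫ s.vertex
  leg k d := s.leg (k ≫ u) d
  comp_leg v k d := by rw [s.comp_leg, Category.assoc]
  leg_src k d := s.leg_src _ _
  leg_tgt k d := by rw [s.leg_tgt, Category.assoc]
  naturality k f := s.naturality _ _

/-- The cocone in context obtained by composing all legs with an arrow out of the vertex. -/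
noncomputable def GenCocone.postcomp {D : InternalFunctor 𝔻 A} {J : C} (s : GenCocone D J)
    (h : J ⟶ A.arr) (hs : h ≫ A.src = s.vertex) : GenCocone D J where
  vertex := h ≫ A.tgt
  leg j d := A.compose (j ≫ h) (s.leg j d) (by rw [Category.assoc, hs, s.leg_tgt])
  comp_leg u j d := by simp only [A.comp_compose, s.comp_leg, Category.assoc]
  leg_src j d := by rw [A.compose_src, s.leg_src]
  leg_tgt j d := by rw [A.compose_tgt, Category.assoc]
  naturality j f := by
    rw [← A.assoc]
    exact A.compose_congr rfl (s.naturality j f) _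

/-- The global cocone as a cocone in the terminal context. -/
noncomputable def InternalCocone.toGenCocone {D : InternalFunctor 𝔻 A} (c : InternalCocone D) :
    GenCocone D (⊤_ C) where
  vertex := c.vertex
  leg _ d := d ≫ c.legs.app
  comp_leg u j d := (Category.assoc _ _ _).symm
  leg_src j d := by rw [Category.assoc, c.legs.app_src]
  leg_tgt j d := by
    rw [Category.assoc, c.legs_tgt, ← Category.assoc]
    congr 1
    exact Subsingleton.elim _ _
  naturality j f := by
    simp only [Category.assoc]
    rw [← c.legs_naturality, A.comp_compose]

end GeneralizedCones

/-! ### The object of cocones -/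

open MonoidalCategory CartesianMonoidalCategory in
theorem CategoryTheory.CartesianMonoidalCategory.lift_whiskerLeft_comp {C : Type u}
    [Category.{v} C] [CartesianMonoidalCategory C]
    {D X Y Z B : C} (d : Z ⟶ D) (x : Z ⟶ X) (u : X ⟶ Y)
    (f : D ⊗ Y ⟶ B) : lift d x ≫ D ◁ u ≫ f = lift d (x ≫ u) ≫ f := by
  rw [← Category.assoc, lift_whiskerLeft]

section Classifier

variable {C : Type u} [Category.{v} C] [HasFiniteLimits C] {𝔻 A : InternalCategory C}

/-- An object `obj` representing the presheaf of cocones in context under `D`, with the generic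
cocone `univ`. -/
structure CoconeClassifier (D : InternalFunctor 𝔻 A) where
  /-- the object of cocones -/
  obj : C
  /-- the generic cocone -/
  univ : GenCocone D obj
  /-- the name of a cocone -/
  classify : ∀ {X : C}, GenCocone D X → (X ⟶ obj)
  classify_vertex : ∀ {X : C} (s : GenCocone D X), classify s ≫ univ.vertex = s.vertex
  leg_classify : ∀ {X Y : C} (s : GenCocone D X) (j : Y ⟶ X) (d : Y ⟶ 𝔻.obj),
    univ.leg (j ≫ classify s) d = s.leg j d
  hom_ext : ∀ {X : C} {k k' : X ⟶ obj}, k ≫ univ.vertex = k' ≫ univ.vertex →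
    (∀ {Y : C} (j : Y ⟶ X) (d : Y ⟶ 𝔻.obj), univ.leg (j ≫ k) d = univ.leg (j ≫ k') d) → k = k'

section Closed

variable [CartesianMonoidalCategory C] [MonoidalClosed C]

open MonoidalCategory CartesianMonoidalCategory

/-- In a cartesian closed category, the elements `y` of `Y` such that `f (d, y) = g (d, y)` for
all `d` form a subobject of `Y`. -/
theorem exists_forall_equalizer {D Y B : C} (f g : D ⊗ Y ⟶ B) :
    ∃ (S : C) (i : S ⟶ Y), Mono i ∧ D ◁ i ≫ f = D ◁ i ≫ g ∧
      ∀ {X : C} (u : X ⟶ Y), D ◁ u ≫ f = D ◁ u ≫ g → ∃ w : X ⟶ S, w ≫ i = u := by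
  refine ⟨equalizer (MonoidalClosed.curry f) (MonoidalClosed.curry g), equalizer.ι _ _,
    inferInstance, ?_, fun u hu => ⟨equalizer.lift u ?_, equalizer.lift_ι _ _⟩⟩
  · apply MonoidalClosed.curry_injective
    rw [MonoidalClosed.curry_natural_left, MonoidalClosed.curry_natural_left, equalizer.condition]
  · rw [← MonoidalClosed.curry_natural_left, ← MonoidalClosed.curry_natural_left, hu]

/-- In a cartesian closed category the cocones under a diagram are represented by an object. It is
carved out of the object of pairs of a vertex and a `𝔻.obj`-indexed family of arrows by the
conditions on sources and targets and by naturality. -/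
theorem CoconeClassifier.nonempty (D : InternalFunctor 𝔻 A) : Nonempty (CoconeClassifier D) := by
  let ev : 𝔻.obj ⊗ (A.obj ⊗ (ihom 𝔻.obj).obj A.arr) ⟶ A.arr :=
    𝔻.obj ◁ snd _ _ ≫ (ihom.ev 𝔻.obj).app A.arr
  have hev {X : C} (a : X ⟶ A.obj) (l : 𝔻.obj ⊗ X ⟶ A.arr) :
      𝔻.obj ◁ lift a (MonoidalClosed.curry l) ≫ ev = l := by
    rw [← MonoidalCategory.whiskerLeft_comp_assoc, lift_snd, ← MonoidalClosed.uncurry_eq,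
      MonoidalClosed.uncurry_curry]
  have hev' {X : C} {k k' : X ⟶ A.obj ⊗ (ihom 𝔻.obj).obj A.arr}
      (h0 : k ≫ fst _ _ = k' ≫ fst _ _) (h1 : 𝔻.obj ◁ k ≫ ev = 𝔻.obj ◁ k' ≫ ev) : k = k' := by
    apply CartesianMonoidalCategory.hom_ext _ _ h0
    rw [← MonoidalCategory.whiskerLeft_comp_assoc, ← MonoidalCategory.whiskerLeft_comp_assoc,
      ← MonoidalClosed.uncurry_eq, ← MonoidalClosed.uncurry_eq] at h1
    exact MonoidalClosed.uncurry_injective h1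
  -- the families with the right sources and targets
  obtain ⟨S, i, hi, hS, lift_S⟩ := exists_forall_equalizer (lift (ev ≫ A.src) (ev ≫ A.tgt))
    (lift (fst _ _ ≫ D.onObj) (snd _ _ ≫ fst _ _))
  have hS_src : (𝔻.obj ◁ i ≫ ev) ≫ A.src = fst _ _ ≫ D.onObj := by
    simpa using hS =≫ fst _ _
  have hS_tgt : (𝔻.obj ◁ i ≫ ev) ≫ A.tgt = snd _ _ ≫ i ≫ fst _ _ := by
    simpa using hS =≫ snd _ _
  -- the families which are moreover natural
  obtain ⟨T, t, ht, hT, lift_T⟩ := exists_forall_equalizer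
    (A.compose (lift (fst _ _ ≫ 𝔻.tgt) (snd _ _) ≫ 𝔻.obj ◁ i ≫ ev) (fst 𝔻.arr S ≫ D.onArr)
      (by rw [Category.assoc, hS_src, lift_fst_assoc, Category.assoc, Category.assoc, D.map_tgt]))
    (lift (fst _ _ ≫ 𝔻.src) (snd _ _) ≫ 𝔻.obj ◁ i ≫ ev)
  let e : 𝔻.obj ⊗ T ⟶ A.arr := 𝔻.obj ◁ (t ≫ i) ≫ ev
  have he {X : C} (d : X ⟶ 𝔻.obj) (j : X ⟶ T) :
      lift d j ≫ e = lift d (j ≫ t) ≫ 𝔻.obj ◁ i ≫ ev := by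
    simp only [e, lift_whiskerLeft_comp, Category.assoc]
  let s : GenCocone D T :=
    { vertex := t ≫ i ≫ fst _ _
      leg := fun j d => lift d j ≫ e
      comp_leg := fun u j d => by rw [← Category.assoc, comp_lift]
      leg_src := fun j d => by rw [he, Category.assoc, hS_src, lift_fst_assoc]
      leg_tgt := fun j d => by rw [he, Category.assoc, hS_tgt, lift_snd_assoc, Category.assoc]
      naturality := fun {X} j f => by
        have h := lift f j ≫= hT
        simp only [A.comp_compose, ← Category.assoc, comp_lift, lift_whiskerLeft, lift_fst,
          lift_snd] at h
        simp only [he]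
        simpa only [Category.assoc, lift_whiskerLeft_comp] using h }
  have key {X : C} (c : GenCocone D X) : ∃ k : X ⟶ T, k ≫ s.vertex = c.vertex ∧
      ∀ {Y : C} (j : Y ⟶ X) (d : Y ⟶ 𝔻.obj), s.leg (j ≫ k) d = c.leg j d := by
    let l : 𝔻.obj ⊗ X ⟶ A.arr := c.leg (snd _ _) (fst _ _)
    obtain ⟨w, hw⟩ := lift_S (lift c.vertex (MonoidalClosed.curry l)) (by
      ext <;> simp only [Category.assoc, lift_fst, lift_snd, whiskerLeft_fst_assoc,
        whiskerLeft_snd_assoc, reassoc_of% (hev c.vertex l)]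
      · exact c.leg_src _ _
      · exact c.leg_tgt _ _)
    have hl {Y : C} (j : Y ⟶ X) (d : Y ⟶ 𝔻.obj) :
        lift d (j ≫ w) ≫ 𝔻.obj ◁ i ≫ ev = c.leg j d := by
      rw [lift_whiskerLeft_comp, Category.assoc, hw, ← lift_whiskerLeft_comp, hev, c.comp_leg,
        lift_fst, lift_snd]
    obtain ⟨k, hk⟩ := lift_T w (by
      simp only [A.comp_compose, ← Category.assoc, comp_lift, whiskerLeft_fst, whiskerLeft_snd]
      simp only [Category.assoc]
      simp only [hl]
      exact c.naturality _ _)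
    refine ⟨k, ?_, fun j d => ?_⟩
    · change k ≫ t ≫ i ≫ _ = _
      rw [reassoc_of% hk, reassoc_of% hw, lift_fst]
    · change lift _ _ ≫ e = _
      rw [he, Category.assoc, hk, hl]
  refine ⟨⟨T, s, fun c => (key c).choose, fun c => (key c).choose_spec.1,
    fun c => (key c).choose_spec.2, fun {X k k'} h0 h1 => ?_⟩⟩
  rw [← cancel_mono t, ← cancel_mono i]
  refine hev' (by simpa only [Category.assoc] using h0) ?_
  have h := h1 (snd 𝔻.obj X) (fst _ _)
  change lift _ _ ≫ e = lift _ _ ≫ e at h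
  rw [he, he] at h
  simp only [lift_whiskerLeft_comp] at h
  have h' (m : X ⟶ T) : 𝔻.obj ◁ ((m ≫ t) ≫ i) = lift (fst _ _) (((snd 𝔻.obj X ≫ m) ≫ t) ≫ i) := by
    ext <;> simp
  rw [h', h']
  exact h

end Closed
end Classifier

/-! ### The internal category of cocones -/

namespace CoconeClassifier

variable {C : Type u} [Category.{v} C] [HasFiniteLimits C] {𝔻 A : InternalCategory C}
  {D : InternalFunctor 𝔻 A} (K : CoconeClassifier D)

/-- The target of the generic arrow out of a cocone: the generic cocone composed with an arrow
out of its vertex. -/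
noncomputable def target : pullback K.univ.vertex A.src ⟶ K.obj :=
  K.classify ((K.univ.reindex (pullback.fst _ _)).postcomp (pullback.snd _ _)
    pullback.condition.symm)

theorem target_vertex : K.target ≫ K.univ.vertex = pullback.snd _ _ ≫ A.tgt :=
  K.classify_vertex _

theorem leg_target {X : C} (p : X ⟶ pullback K.univ.vertex A.src) (d : X ⟶ 𝔻.obj) :
    K.univ.leg (p ≫ K.target) d =
      A.compose (p ≫ pullback.snd _ _) (K.univ.leg (p ≫ pullback.fst _ _) d)
        (by rw [Category.assoc, ← pullback.condition, K.univ.leg_tgt, Category.assoc]) :=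
  K.leg_classify _ _ _

theorem leg_comp_target {X Y : C} (j : Y ⟶ X) (p : X ⟶ pullback K.univ.vertex A.src)
    (d : Y ⟶ 𝔻.obj) : K.univ.leg (j ≫ p ≫ K.target) d =
      A.compose (j ≫ p ≫ pullback.snd _ _) (K.univ.leg (j ≫ p ≫ pullback.fst _ _) d)
        (by simp [← pullback.condition, K.univ.leg_tgt]) := by
  rw [← Category.assoc, leg_target]
  simp only [Category.assoc]

/-- A morphism of cocones is recognized by its underlying arrow and its effect on legs. -/
theorem comp_target_eq {X : C} {p : X ⟶ pullback K.univ.vertex A.src} {k : X ⟶ K.obj}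
    (h0 : (p ≫ pullback.snd _ _) ≫ A.tgt = k ≫ K.univ.vertex)
    (h1 : ∀ {Y : C} (j : Y ⟶ X) (d : Y ⟶ 𝔻.obj),
      A.compose (j ≫ p ≫ pullback.snd _ _) (K.univ.leg (j ≫ p ≫ pullback.fst _ _) d)
        (by simp [← pullback.condition, K.univ.leg_tgt]) = K.univ.leg (j ≫ k) d) :
    p ≫ K.target = k := by
  refine K.hom_ext (by rw [Category.assoc, K.target_vertex, ← h0, Category.assoc]) fun j d => ?_
  rw [← h1, leg_comp_target]

/-- The identity morphisms of cocones. -/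
noncomputable def ident : K.obj ⟶ pullback K.univ.vertex A.src :=
  pullback.lift (𝟙 _) (K.univ.vertex ≫ A.ident) (by simp [A.ident_src])

theorem ident_target : K.ident ≫ K.target = 𝟙 _ := by
  refine K.comp_target_eq ?_ fun {Y} j d => ?_
  · simp [ident, pullback.lift_snd_assoc, A.ident_tgt]
  · simp only [ident, pullback.lift_fst, pullback.lift_snd, Category.comp_id]
    rw [A.compose_congr (Category.assoc _ _ _).symm rfl]
    exact A.ident_compose' _ _ (K.univ.leg_tgt _ _)

theorem snd_src_eq_snd_tgt {X : C} {q p : X ⟶ pullback K.univ.vertex A.src}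
    (h : q ≫ pullback.fst _ _ = p ≫ K.target) :
    (q ≫ pullback.snd _ _) ≫ A.src = (p ≫ pullback.snd _ _) ≫ A.tgt := by
  rw [Category.assoc, ← pullback.condition, reassoc_of% h, K.target_vertex, Category.assoc]

/-- The composite `q ∘ p` of morphisms of cocones. -/
noncomputable def compose {X : C} (q p : X ⟶ pullback K.univ.vertex A.src)
    (h : q ≫ pullback.fst _ _ = p ≫ K.target) : X ⟶ pullback K.univ.vertex A.src :=
  pullback.lift (p ≫ pullback.fst _ _)
    (A.compose (q ≫ pullback.snd _ _) (p ≫ pullback.snd _ _) (K.snd_src_eq_snd_tgt h))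
    (by rw [A.compose_src, Category.assoc, Category.assoc, pullback.condition])

theorem compose_fst {X : C} (q p : X ⟶ pullback K.univ.vertex A.src)
    (h : q ≫ pullback.fst _ _ = p ≫ K.target) :
    K.compose q p h ≫ pullback.fst _ _ = p ≫ pullback.fst _ _ :=
  pullback.lift_fst _ _ _

theorem compose_snd {X : C} (q p : X ⟶ pullback K.univ.vertex A.src)
    (h : q ≫ pullback.fst _ _ = p ≫ K.target) :
    K.compose q p h ≫ pullback.snd _ _ =
      A.compose (q ≫ pullback.snd _ _) (p ≫ pullback.snd _ _) (K.snd_src_eq_snd_tgt h) :=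
  pullback.lift_snd _ _ _

theorem compose_target {X : C} (q p : X ⟶ pullback K.univ.vertex A.src)
    (h : q ≫ pullback.fst _ _ = p ≫ K.target) : K.compose q p h ≫ K.target = q ≫ K.target := by
  refine K.comp_target_eq ?_ fun {Y} j d => ?_
  · rw [compose_snd, A.compose_tgt, Category.assoc, Category.assoc, K.target_vertex]
  · have e : K.univ.leg (j ≫ q ≫ pullback.fst _ _) d =
        A.compose (j ≫ p ≫ pullback.snd _ _) (K.univ.leg (j ≫ p ≫ pullback.fst _ _) d)
          (by simp [← pullback.condition, K.univ.leg_tgt]) := by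
      rw [h, K.leg_comp_target]
    simp only [compose_fst, compose_snd, A.comp_compose]
    rw [K.leg_comp_target, ← A.assoc]
    exact A.compose_congr rfl e.symm _

/-- The underlying data of the internal category of cocones under `D`. An arrow is a cocone
together with an arrow of `A` out of its vertex, since the target cocone is then determined. -/
noncomputable abbrev preCategory : PreInternalCategory C where
  obj := K.obj
  arr := pullback K.univ.vertex A.src
  src := pullback.fst _ _
  tgt := K.target
  ident := K.ident
  comp := K.compose (pullback.fst _ _) (pullback.snd _ _) pullback.condition
  ident_src := pullback.lift_fst _ _ _
  ident_tgt := K.ident_target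
  comp_src := K.compose_fst _ _ _
  comp_tgt := K.compose_target _ _ _

theorem preCategory_compose {X : C} (q p : X ⟶ pullback K.univ.vertex A.src)
    (h : q ≫ pullback.fst _ _ = p ≫ K.target) :
    K.preCategory.compose q p h = K.compose q p h := by
  have e : K.preCategory.compose q p h = pullback.lift q p h ≫
    K.compose (pullback.fst _ _) (pullback.snd _ _) pullback.condition := rfl
  rw [e]
  apply pullback.hom_ext
  · rw [Category.assoc, compose_fst, compose_fst, pullback.lift_snd_assoc]
  · rw [Category.assoc, compose_snd, compose_snd, A.comp_compose]
    exact A.compose_congr (pullback.lift_fst_assoc _ _ _ _) (pullback.lift_snd_assoc _ _ _ _) _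

/-- The internal category of cocones under `D`. -/
noncomputable abbrev category : InternalCategory C where
  toPreInternalCategory := K.preCategory
  assoc {X} h g f hg gf := by
    simp only [preCategory_compose]
    apply pullback.hom_ext
    · simp only [compose_fst]
    · simp only [compose_snd]
      exact A.assoc _ _ _ _ _
  comp_ident {X} f := by
    rw [preCategory_compose]
    apply pullback.hom_ext
    · rw [compose_fst, Category.assoc]
      exact (_ ≫= pullback.lift_fst _ _ _).trans (Category.comp_id _)
    · rw [compose_snd]
      refine (A.compose_congr rfl ((Category.assoc _ _ _).trans
        ((_ ≫= pullback.lift_snd _ _ _).trans (Category.assoc _ _ _).symm)) _).trans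
          (A.compose_ident' _ _ ?_)
      rw [Category.assoc, Category.assoc, pullback.condition]
  ident_comp {X} f := by
    rw [preCategory_compose]
    apply pullback.hom_ext
    · rw [compose_fst]
    · rw [compose_snd]
      refine (A.compose_congr ((Category.assoc _ _ _).trans
        ((_ ≫= pullback.lift_snd _ _ _).trans (Category.assoc _ _ _).symm)) rfl _).trans
          (A.ident_compose' _ _ ?_)
      rw [Category.assoc, Category.assoc, K.target_vertex]

/-- The forgetful functor sending a cocone to its vertex. -/
noncomputable def forget : InternalFunctor K.category A where
  onObj := K.univ.vertex
  onArr := pullback.snd _ _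
  map_src := pullback.condition.symm
  map_tgt := K.target_vertex.symm
  map_ident := pullback.lift_snd _ _ _
  map_comp q p h := (K.preCategory_compose q p h =≫ _).trans (K.compose_snd q p h)

variable {K}

/-- The legs at `d` of all cocones form a cone over the forgetful functor with vertex `D d`. This
is a cone in context `𝔻.obj`. -/
def legCone : GenCone K.forget 𝔻.obj where
  vertex := D.onObj
  leg d k := K.univ.leg k d
  comp_leg u d k := K.univ.comp_leg u k d
  leg_src d k := K.univ.leg_src k d
  leg_tgt d k := K.univ.leg_tgt k d
  naturality d p := (K.leg_target p d).symm

variable {L : InternalCone K.forget}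

theorem legs_naturality {X : C} (p : X ⟶ pullback K.univ.vertex A.src) :
    A.compose (p ≫ pullback.snd _ _) (p ≫ pullback.fst _ _ ≫ L.legs.app)
      (by
        rw [Category.assoc, ← pullback.condition, Category.assoc, Category.assoc,
          L.legs.app_tgt]; rfl) = (p ≫ K.target) ≫ L.legs.app :=
  (A.comp_compose p _ _ _).symm.trans
    ((p ≫= L.legs_naturality).trans (Category.assoc _ _ _).symm)

end CoconeClassifier

/-! ### Colimits from limits of forgetful functors -/

theorem CategoryTheory.Limits.terminal.from_terminal_comp {C : Type u} [Category.{v} C]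
    [HasTerminal C] {X : C} (f : ⊤_ C ⟶ X) : terminal.from (⊤_ C) ≫ f = f := by
  rw [Subsingleton.elim (terminal.from (⊤_ C)) (𝟙 _), Category.id_comp]

section Colimit

variable {C : Type u} [Category.{v} C] [HasFiniteLimits C] {𝔻 A : InternalCategory C}
  {D : InternalFunctor 𝔻 A} {K : CoconeClassifier D} {L : InternalCone K.forget}

/-- The cocone whose leg at `d` is the map into the limit of the forgetful functor induced by the
legs at `d` of all cocones. -/
theorem exists_cocone_of_cone
    (hL : ∀ (J : C) (s : GenCone K.forget J), ∃! h, s.IsHom L h) :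
    ∃ c : InternalCocone D, c.vertex = L.vertex ∧
      (CoconeClassifier.legCone (K := K)).IsHom L c.legs.app := by
  obtain ⟨h, hh, -⟩ := hL _ (CoconeClassifier.legCone (K := K))
  refine ⟨⟨L.vertex, ⟨h, hh.src, hh.tgt, ?_⟩⟩, rfl, hh⟩
  have e : 𝔻.tgt ≫ h ≫ A.src = D.onArr ≫ A.tgt := by rw [hh.src, D.map_tgt]; rfl
  -- both sides are the map induced by the cone of legs at the source of the generic arrow of `𝔻`
  have h1 : (CoconeClassifier.legCone.reindex 𝔻.src).IsHom L
      (A.compose (𝔻.tgt ≫ h) D.onArr (by rw [Category.assoc, e])) := by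
    refine ⟨by rw [A.compose_src, D.map_src]; rfl, ?_, fun {X} f k => ?_⟩
    · rw [A.compose_tgt, Category.assoc, hh.tgt]; simp
    · have := hh.fac (f ≫ 𝔻.tgt) k
      simp only [Category.assoc] at this
      simp only [A.comp_compose]
      rw [A.assoc _ _ _ (by simp [hh.tgt, L.legs_src]) (by simp [e]), A.compose_congr this rfl]
      exact K.univ.naturality k f
  have h2 : (CoconeClassifier.legCone.reindex 𝔻.src).IsHom L (𝔻.src ≫ h) := by
    refine ⟨by rw [Category.assoc, hh.src]; rfl, by rw [Category.assoc, hh.tgt]; simp,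
      fun {X} f k => ?_⟩
    simp only [← Category.assoc]
    exact hh.fac (f ≫ 𝔻.src) k
  refine ((hL _ _).unique h1 h2).trans ?_
  symm
  refine (A.compose_congr (Category.assoc _ _ _).symm rfl _).trans (A.ident_compose' _ _ ?_)
  rw [Category.assoc, hh.tgt]; simp

/-- If the forgetful functor from cocones under `D` has a limit, then the limit is the vertex of a
colimit cocone. The morphism to another cocone `k` is the leg of the limit cone at `k`. -/
theorem exists_universal_genCocone
    (hL : ∀ (J : C) (s : GenCone K.forget J), ∃! h, s.IsHom L h) :
    ∃ c : InternalCocone D, ∀ (J : C) (s : GenCocone D J), ∃! h, s.IsHom c h := by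
  obtain ⟨c, hc, hh⟩ := exists_cocone_of_cone hL
  have src_app {X : C} (k : X ⟶ K.obj) :
      (k ≫ L.legs.app) ≫ A.src = terminal.from X ≫ L.vertex := by
    rw [Category.assoc, L.legs_src]; simp
  have tgt_app {X : C} (k : X ⟶ K.obj) : (k ≫ L.legs.app) ≫ A.tgt = k ≫ K.univ.vertex := by
    rw [Category.assoc, L.legs.app_tgt]; rfl
  let kL : ⊤_ C ⟶ K.obj := K.classify c.toGenCocone
  have kL_vertex : kL ≫ K.univ.vertex = L.vertex := (K.classify_vertex _).trans hc
  have kL_leg {X : C} (j : X ⟶ ⊤_ C) (d : X ⟶ 𝔻.obj) : K.univ.leg (j ≫ kL) d = d ≫ c.legs.app :=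
    K.leg_classify _ _ _
  -- an arrow out of `L` commuting with the legs is a morphism of cocones out of `kL`
  have nat {J : C} (k : J ⟶ K.obj) (m : J ⟶ A.arr) (hs : m ≫ A.src = terminal.from J ≫ L.vertex)
      (ht : m ≫ A.tgt = k ≫ K.univ.vertex)
      (hm : ∀ {X : C} (j : X ⟶ J) (d : X ⟶ 𝔻.obj), A.compose (j ≫ m) (d ≫ c.legs.app)
        (by simp [hs, c.legs_tgt, hc]) = K.univ.leg (j ≫ k) d) :
      A.compose m (terminal.from J ≫ kL ≫ L.legs.app)
        (by simpa only [Category.assoc, kL_vertex, hs] using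
          (tgt_app (terminal.from J ≫ kL)).symm) = k ≫ L.legs.app := by
    let p : J ⟶ pullback K.univ.vertex A.src :=
      pullback.lift (terminal.from J ≫ kL) m (by rw [Category.assoc, kL_vertex, hs])
    have hp : p ≫ K.target = k := by
      apply K.comp_target_eq
      · simp [p, ht, pullback.lift_snd]
      · intro Y j d
        simp only [p, pullback.lift_snd, pullback.lift_fst]
        rw [← hm, A.compose_congr rfl]
        rw [← Category.assoc, kL_leg]
    have := CoconeClassifier.legs_naturality (L := L) p
    rw [hp] at this
    rw [← this]
    refine A.compose_congr (pullback.lift_snd _ _ _).symm ?_ _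
    rw [pullback.lift_fst_assoc, Category.assoc]
  have fac {J : C} (k : J ⟶ K.obj) (d : J ⟶ 𝔻.obj) :
      A.compose (k ≫ L.legs.app) (d ≫ c.legs.app)
        (by simp [src_app, c.legs_tgt, hc]) = K.univ.leg k d := hh.fac d k
  -- the leg at `kL` is the identity, as both are endomorphisms of the limit cone
  have leg_kL : kL ≫ L.legs.app = L.vertex ≫ A.ident := by
    let s : GenCone K.forget (⊤_ C) :=
      { vertex := L.vertex
        leg := fun _ k => k ≫ L.legs.app
        comp_leg := fun u j k => (Category.assoc _ _ _).symm
        leg_src := fun j k => by rw [src_app]; congr 1; exact Subsingleton.elim _ _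
        leg_tgt := fun j k => tgt_app k
        naturality := fun j p => by
          refine Eq.trans ?_ (CoconeClassifier.legs_naturality p)
          exact A.compose_congr rfl (Category.assoc _ _ _) _ }
    have h1 : s.IsHom L (kL ≫ L.legs.app) := by
      refine ⟨?_, ?_, fun {X} j k => ?_⟩
      · rw [src_app, terminal.from_terminal_comp]
      · rw [tgt_app, kL_vertex, terminal.from_terminal_comp]
      · obtain rfl : j = terminal.from X := Subsingleton.elim _ _
        refine nat k _ (src_app k) (tgt_app k) fun j d => ?_
        simp only [← Category.assoc]
        exact fac _ _
    have h2 : s.IsHom L (L.vertex ≫ A.ident) := by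
      refine ⟨by simp [A.ident_src, s],
        by rw [Category.assoc, A.ident_tgt, Category.comp_id, terminal.from_terminal_comp],
        fun {X} j k => ?_⟩
      rw [A.compose_congr rfl (Category.assoc _ _ _).symm]
      refine A.compose_ident' _ _ ?_
      rw [src_app]; congr 1; exact Subsingleton.elim _ _
    exact (hL _ s).unique h1 h2
  refine ⟨c, fun J s => ⟨K.classify s ≫ L.legs.app, ⟨?_, ?_, fun {X} j d => ?_⟩, fun m hm => ?_⟩⟩
  · rw [src_app, hc]
  · rw [tgt_app, K.classify_vertex]
  · simp only [← Category.assoc]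
    exact (fac _ _).trans (K.leg_classify s j d)
  · rw [← nat (K.classify s) m (by rw [hm.src, hc]) (by rw [hm.tgt, K.classify_vertex])
      fun j d => (hm.fac j d).trans (K.leg_classify s j d).symm]
    symm
    rw [A.compose_congr rfl (by rw [leg_kL, ← Category.assoc])]
    exact A.compose_ident' _ _ (by rw [hm.src, hc])

end Colimit

/-! ### Base change and cones in context -/

section BaseChange

variable {C : Type u} [Category.{v} C] [HasFiniteLimits C] {J : C}

/-- Maps `T ⟶ J^* Y` over `J` correspond to maps `T ⟶ Y`. -/
noncomputable def starHomEquiv {T : Over J} {Y : C} :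
    (T ⟶ (Over.star J).obj Y) ≃ (T.left ⟶ Y) :=
  ((Over.forgetAdjStar J).homEquiv T Y).symm

theorem starHomEquiv_comp {S T : Over J} {Y : C} (k : S ⟶ T) (f : T ⟶ (Over.star J).obj Y) :
    starHomEquiv (k ≫ f) = k.left ≫ starHomEquiv f :=
  (Over.forgetAdjStar J).homEquiv_naturality_left_symm k f

theorem starHomEquiv_comp_map {T : Over J} {Y Z : C} (f : T ⟶ (Over.star J).obj Y) (g : Y ⟶ Z) :
    starHomEquiv (f ≫ (Over.star J).map g) = starHomEquiv f ≫ g :=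
  (Over.forgetAdjStar J).homEquiv_naturality_right_symm f g

theorem starHomEquiv_compose (A : InternalCategory C) {T : Over J}
    (g f : T ⟶ (A.baseChange J).arr) (h : g ≫ (A.baseChange J).src = f ≫ (A.baseChange J).tgt) :
    starHomEquiv ((A.baseChange J).compose g f h) = A.compose (starHomEquiv g) (starHomEquiv f)
      (by rw [← starHomEquiv_comp_map, ← starHomEquiv_comp_map]; exact congrArg starHomEquiv h) := by
  obtain ⟨u, hg, hf⟩ := A.exists_pair (Over.star J) g f h
  refine (congrArg starHomEquiv
    (A.map_compose (Over.star J) u _ _ pullback.condition hg hf h)).trans ?_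
  rw [starHomEquiv_comp_map, A.comp_compose]
  refine A.compose_congr ?_ ?_ _
  · rw [hg, starHomEquiv_comp_map]
  · rw [hf, starHomEquiv_comp_map]

/-- Global elements of `J^* Y` over `J` correspond to maps `J ⟶ Y`. -/
noncomputable def globalStarEquiv {Y : C} : (⊤_ (Over J) ⟶ (Over.star J).obj Y) ≃ (J ⟶ Y) :=
  ((terminalIsTerminal.uniqueUpToIso Over.mkIdTerminal).homFromEquiv).trans
    (starHomEquiv (T := Over.mk (𝟙 J)))

theorem starHomEquiv_terminal_comp (T : Over J) {Y : C} (f : ⊤_ (Over J) ⟶ (Over.star J).obj Y) :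
    starHomEquiv (terminal.from T ≫ f) = T.hom ≫ globalStarEquiv f := by
  have e : terminal.from T ≫ f = (Over.homMk T.hom : T ⟶ Over.mk (𝟙 J)) ≫
      (terminalIsTerminal.uniqueUpToIso Over.mkIdTerminal).inv ≫ f := by
    rw [← Category.assoc]
    congr 1
    exact Subsingleton.elim _ _
  rw [e, starHomEquiv_comp]
  rfl

theorem globalStarEquiv_comp_map {Y Z : C} (f : ⊤_ (Over J) ⟶ (Over.star J).obj Y) (g : Y ⟶ Z) :
    globalStarEquiv (f ≫ (Over.star J).map g) = globalStarEquiv f ≫ g := by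
  have e := starHomEquiv_comp_map
    ((terminalIsTerminal.uniqueUpToIso Over.mkIdTerminal).inv ≫ f : Over.mk (𝟙 J) ⟶ _) g
  rw [Category.assoc] at e
  exact e

theorem globalStarEquiv_map_terminal {Y : C} (a : ⊤_ C ⟶ Y) :
    globalStarEquiv ((PreservesTerminal.iso (Over.star J)).inv ≫ (Over.star J).map a) =
      terminal.from J ≫ a := by
  rw [globalStarEquiv_comp_map]
  congr 1
  exact Subsingleton.elim _ _

theorem starHomEquiv_map {X Y : C} (f : X ⟶ Y) :
    starHomEquiv ((Over.star J).map f) = starHomEquiv (𝟙 ((Over.star J).obj X)) ≫ f := by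
  rw [← starHomEquiv_comp_map, Category.id_comp]

variable {𝔻 A : InternalCategory C} {D : InternalFunctor 𝔻 A}

/-- The cone `c` over `J^* D` and the cone `s` over `D` in context `J` are transposes of each
other. -/
structure GenCone.IsTranspose (s : GenCone D J) (c : InternalCone (D.baseChange J)) : Prop where
  vertex : globalStarEquiv c.vertex = s.vertex
  leg : ∀ {T : Over J} (d : T ⟶ (Over.star J).obj 𝔻.obj),
    starHomEquiv (d ≫ c.legs.app) = s.leg T.hom (starHomEquiv d)

theorem InternalCone.exists_isTranspose (c : InternalCone (D.baseChange J)) :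
    ∃ s : GenCone D J, s.IsTranspose c := by
  let l {X : C} (j : X ⟶ J) (d : X ⟶ 𝔻.obj) : X ⟶ A.arr :=
    starHomEquiv ((starHomEquiv.symm d : Over.mk j ⟶ _) ≫ c.legs.app)
  have hl {T : Over J} (d : T ⟶ (Over.star J).obj 𝔻.obj) :
      starHomEquiv (d ≫ c.legs.app) = l T.hom (starHomEquiv d) := by
    change _ = starHomEquiv ((starHomEquiv.symm (starHomEquiv d) : T ⟶ _) ≫ c.legs.app)
    rw [Equiv.symm_apply_apply]
  have l_src {X : C} (j : X ⟶ J) (d : X ⟶ 𝔻.obj) :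
      l j d ≫ A.src = j ≫ globalStarEquiv c.vertex := by
    rw [← starHomEquiv_comp_map, Category.assoc]
    refine (congrArg starHomEquiv (_ ≫= c.legs_src)).trans ?_
    rw [← Category.assoc, terminal.comp_from]
    exact starHomEquiv_terminal_comp (Over.mk j) _
  have l_tgt {X : C} (j : X ⟶ J) (d : X ⟶ 𝔻.obj) : l j d ≫ A.tgt = d ≫ D.onObj := by
    rw [← starHomEquiv_comp_map, Category.assoc]
    refine (congrArg starHomEquiv (_ ≫= c.legs.app_tgt)).trans ?_
    refine (starHomEquiv_comp_map _ _).trans ?_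
    rw [Equiv.apply_symm_apply]
  refine ⟨⟨globalStarEquiv c.vertex, l, fun u j d => ?_, l_src, l_tgt, fun {X} j f => ?_⟩, rfl, hl⟩
  · refine (starHomEquiv_comp (Over.homMk u : Over.mk (u ≫ j) ⟶ Over.mk j) _).symm.trans ?_
    rw [← Category.assoc, hl, starHomEquiv_comp, Equiv.apply_symm_apply]
    rfl
  · let f' : Over.mk j ⟶ (Over.star J).obj 𝔻.arr := starHomEquiv.symm f
    have hf' {Y : C} (g : 𝔻.arr ⟶ Y) : starHomEquiv (f' ≫ (Over.star J).map g) = f ≫ g := by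
      rw [starHomEquiv_comp_map, Equiv.apply_symm_apply]
    have e := congrArg starHomEquiv (f' ≫= c.legs_naturality)
    rw [PreInternalCategory.comp_compose, starHomEquiv_compose] at e
    refine Eq.trans (A.compose_congr (hf' _).symm ?_ _) (e.trans ?_)
    · rw [← Category.assoc, hl, hf']
    · rw [← Category.assoc, hl, hf']

theorem GenCone.exists_isTranspose (s : GenCone D J) :
    ∃ c : InternalCone (D.baseChange J), s.IsTranspose c := by
  let app : (Over.star J).obj 𝔻.obj ⟶ (Over.star J).obj A.arr :=
    starHomEquiv.symm (s.leg ((Over.star J).obj 𝔻.obj).hom (starHomEquiv (𝟙 _)))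
  have happ {T : Over J} (d : T ⟶ (Over.star J).obj 𝔻.obj) :
      starHomEquiv (d ≫ app) = s.leg T.hom (starHomEquiv d) := by
    rw [starHomEquiv_comp, Equiv.apply_symm_apply, s.comp_leg, Over.w, ← starHomEquiv_comp,
      Category.comp_id]
  have happ' : starHomEquiv app = s.leg ((Over.star J).obj 𝔻.obj).hom (starHomEquiv (𝟙 _)) :=
    Equiv.apply_symm_apply _ _
  have app_src : app ≫ (Over.star J).map A.src =
      terminal.from _ ≫ globalStarEquiv.symm s.vertex := by
    apply starHomEquiv.injective
    rw [starHomEquiv_comp_map, starHomEquiv_terminal_comp, happ', s.leg_src,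
      Equiv.apply_symm_apply]
  have app_tgt : app ≫ (Over.star J).map A.tgt = (Over.star J).map D.onObj := by
    apply starHomEquiv.injective
    rw [starHomEquiv_comp_map, happ', s.leg_tgt, starHomEquiv_map]
  refine ⟨⟨globalStarEquiv.symm s.vertex, ⟨app, app_src, app_tgt, ?_⟩⟩,
    Equiv.apply_symm_apply _ _, happ⟩
  refine Eq.trans (b := (Over.star J).map 𝔻.tgt ≫ app) ?_ ?_
  · refine ((A.baseChange J).compose_congr rfl (Category.assoc _ _ _).symm _).trans
      ((A.baseChange J).compose_ident' _ _ ?_)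
    refine (Category.assoc _ _ _).trans ((_ ≫= app_src).trans ?_)
    rw [← Category.assoc, terminal.comp_from]
  · apply starHomEquiv.injective
    rw [starHomEquiv_compose, happ]
    have e := s.naturality ((Over.star J).obj 𝔻.arr).hom (starHomEquiv (𝟙 _))
    simp only [← starHomEquiv_map] at e
    rw [← e]
    exact A.compose_congr rfl (happ _).symm _

/-- Global arrows of `J^* A` correspond to arrows of `A` in context `J`, and this identifies the
morphisms `c' ⟶ J^* c` with the morphisms from the transpose of `c'` to `c`. -/
theorem GenCone.IsTranspose.existsUnique_isHom_iff {s : GenCone D J}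
    {c' : InternalCone (D.baseChange J)} (hs : s.IsTranspose c') (c : InternalCone D) :
    (∃! h, s.IsHom c h) ↔ Nonempty (Unique (c' ⟶ c.baseChange J)) := by
  have hs' : starHomEquiv c'.legs.app =
      s.leg ((Over.star J).obj 𝔻.obj).hom (starHomEquiv (𝟙 _)) := by
    rw [← hs.leg, Category.id_comp]
  have h1 (f : InternalCone.Hom c' (c.baseChange J)) : s.IsHom c (globalStarEquiv f.hom) := by
    refine ⟨?_, ?_, fun {X} j d => ?_⟩
    · rw [← globalStarEquiv_comp_map, ← hs.vertex]
      exact congrArg globalStarEquiv f.hom_src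
    · rw [← globalStarEquiv_comp_map]
      exact (congrArg globalStarEquiv f.hom_tgt).trans (globalStarEquiv_map_terminal _)
    · have e := congrArg starHomEquiv ((starHomEquiv.symm d : Over.mk j ⟶ _) ≫= f.w)
      rw [hs.leg, Equiv.apply_symm_apply, PreInternalCategory.comp_compose,
        starHomEquiv_compose] at e
      refine Eq.trans (A.compose_congr ?_ ?_ _) e
      · have e1 := starHomEquiv_comp_map (starHomEquiv.symm d : Over.mk j ⟶ _) c.legs.app
        rw [Equiv.apply_symm_apply] at e1
        exact e1.symm
      · rw [← Category.assoc, terminal.comp_from, starHomEquiv_terminal_comp]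
        rfl
  have h2 (h : J ⟶ A.arr) (hh : s.IsHom c h) :
      ∃ f : InternalCone.Hom c' (c.baseChange J), globalStarEquiv f.hom = h := by
    refine ⟨⟨globalStarEquiv.symm h, ?_, ?_, ?_⟩, Equiv.apply_symm_apply _ _⟩
    · apply globalStarEquiv.injective
      rw [globalStarEquiv_comp_map, Equiv.apply_symm_apply, hs.vertex, hh.src]
    · apply globalStarEquiv.injective
      rw [globalStarEquiv_comp_map, Equiv.apply_symm_apply, hh.tgt]
      exact (globalStarEquiv_map_terminal _).symm
    · apply starHomEquiv.injective
      rw [starHomEquiv_compose, hs', ← hh.fac]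
      refine A.compose_congr (starHomEquiv_map _) ?_ _
      rw [starHomEquiv_terminal_comp, Equiv.apply_symm_apply]
  constructor
  · rintro ⟨h, hh, hu⟩
    obtain ⟨f, hf⟩ := h2 h hh
    refine ⟨⟨⟨f⟩, fun g => InternalCone.Hom.ext (globalStarEquiv.injective ?_)⟩⟩
    exact (hu _ (h1 g)).trans hf.symm
  · rintro ⟨⟨⟨f⟩, hu⟩⟩
    refine ⟨_, h1 f, fun h hh => ?_⟩
    obtain ⟨g, rfl⟩ := h2 h hh
    exact congrArg (fun k : InternalCone.Hom c' (c.baseChange J) => globalStarEquiv k.hom) (hu g)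

/-- Universality of a cone, expressed with cones in context instead of base change. -/
theorem InternalCone.isUniversal_iff (c : InternalCone D) :
    c.IsUniversal ↔ ∀ (J : C) (s : GenCone D J), ∃! h, s.IsHom c h := by
  constructor
  · intro hc J s
    obtain ⟨c', hc'⟩ := s.exists_isTranspose
    obtain ⟨hJ⟩ := hc J
    exact (hc'.existsUnique_isHom_iff c).2 ⟨⟨⟨hJ.from c'⟩, fun f => hJ.hom_ext _ _⟩⟩
  · intro hc J
    have (c' : InternalCone (D.baseChange J)) : Nonempty (Unique (c' ⟶ c.baseChange J)) := by
      obtain ⟨s, hs⟩ := c'.exists_isTranspose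
      exact (hs.existsUnique_isHom_iff c).1 (hc J s)
    have (c' : InternalCone (D.baseChange J)) := (this c').some
    exact ⟨IsTerminal.ofUnique _⟩

/-- The cocone `c` under `J^* D` and the cocone `s` under `D` in context `J` are transposes of each
other. -/
structure GenCocone.IsTranspose (s : GenCocone D J) (c : InternalCocone (D.baseChange J)) : Prop where
  vertex : globalStarEquiv c.vertex = s.vertex
  leg : ∀ {T : Over J} (d : T ⟶ (Over.star J).obj 𝔻.obj),
    starHomEquiv (d ≫ c.legs.app) = s.leg T.hom (starHomEquiv d)

theorem InternalCocone.exists_isTranspose (c : InternalCocone (D.baseChange J)) :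
    ∃ s : GenCocone D J, s.IsTranspose c := by
  let l {X : C} (j : X ⟶ J) (d : X ⟶ 𝔻.obj) : X ⟶ A.arr :=
    starHomEquiv ((starHomEquiv.symm d : Over.mk j ⟶ _) ≫ c.legs.app)
  have hl {T : Over J} (d : T ⟶ (Over.star J).obj 𝔻.obj) :
      starHomEquiv (d ≫ c.legs.app) = l T.hom (starHomEquiv d) := by
    change _ = starHomEquiv ((starHomEquiv.symm (starHomEquiv d) : T ⟶ _) ≫ c.legs.app)
    rw [Equiv.symm_apply_apply]
  have l_tgt {X : C} (j : X ⟶ J) (d : X ⟶ 𝔻.obj) :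
      l j d ≫ A.tgt = j ≫ globalStarEquiv c.vertex := by
    rw [← starHomEquiv_comp_map, Category.assoc]
    refine (congrArg starHomEquiv (_ ≫= c.legs_tgt)).trans ?_
    rw [← Category.assoc, terminal.comp_from]
    exact starHomEquiv_terminal_comp (Over.mk j) _
  have l_src {X : C} (j : X ⟶ J) (d : X ⟶ 𝔻.obj) : l j d ≫ A.src = d ≫ D.onObj := by
    rw [← starHomEquiv_comp_map, Category.assoc]
    refine (congrArg starHomEquiv (_ ≫= c.legs.app_src)).trans ?_
    refine (starHomEquiv_comp_map _ _).trans ?_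
    rw [Equiv.apply_symm_apply]
  refine ⟨⟨globalStarEquiv c.vertex, l, fun u j d => ?_, l_src, l_tgt, fun {X} j f => ?_⟩, rfl, hl⟩
  · refine (starHomEquiv_comp (Over.homMk u : Over.mk (u ≫ j) ⟶ Over.mk j) _).symm.trans ?_
    rw [← Category.assoc, hl, starHomEquiv_comp, Equiv.apply_symm_apply]
    rfl
  · let f' : Over.mk j ⟶ (Over.star J).obj 𝔻.arr := starHomEquiv.symm f
    have hf' {Y : C} (g : 𝔻.arr ⟶ Y) : starHomEquiv (f' ≫ (Over.star J).map g) = f ≫ g := by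
      rw [starHomEquiv_comp_map, Equiv.apply_symm_apply]
    have e := congrArg starHomEquiv (f' ≫= c.legs_naturality)
    rw [PreInternalCategory.comp_compose, starHomEquiv_compose] at e
    refine Eq.trans (A.compose_congr ?_ (hf' _).symm _) (e.trans ?_)
    · rw [← Category.assoc, hl, hf']
    · rw [← Category.assoc, hl, hf']

theorem GenCocone.exists_isTranspose (s : GenCocone D J) :
    ∃ c : InternalCocone (D.baseChange J), s.IsTranspose c := by
  let app : (Over.star J).obj 𝔻.obj ⟶ (Over.star J).obj A.arr :=
    starHomEquiv.symm (s.leg ((Over.star J).obj 𝔻.obj).hom (starHomEquiv (𝟙 _)))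
  have happ {T : Over J} (d : T ⟶ (Over.star J).obj 𝔻.obj) :
      starHomEquiv (d ≫ app) = s.leg T.hom (starHomEquiv d) := by
    rw [starHomEquiv_comp, Equiv.apply_symm_apply, s.comp_leg, Over.w, ← starHomEquiv_comp,
      Category.comp_id]
  have happ' : starHomEquiv app = s.leg ((Over.star J).obj 𝔻.obj).hom (starHomEquiv (𝟙 _)) :=
    Equiv.apply_symm_apply _ _
  have app_src : app ≫ (Over.star J).map A.src = (Over.star J).map D.onObj := by
    apply starHomEquiv.injective
    rw [starHomEquiv_comp_map, happ', s.leg_src, starHomEquiv_map]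
  have app_tgt : app ≫ (Over.star J).map A.tgt =
      terminal.from _ ≫ globalStarEquiv.symm s.vertex := by
    apply starHomEquiv.injective
    rw [starHomEquiv_comp_map, starHomEquiv_terminal_comp, happ', s.leg_tgt,
      Equiv.apply_symm_apply]
  refine ⟨⟨globalStarEquiv.symm s.vertex, ⟨app, app_src, app_tgt, ?_⟩⟩,
    Equiv.apply_symm_apply _ _, happ⟩
  refine Eq.trans (b := (Over.star J).map 𝔻.src ≫ app) ?_ ?_
  · apply starHomEquiv.injective
    rw [starHomEquiv_compose]
    have e := s.naturality ((Over.star J).obj 𝔻.arr).hom (starHomEquiv (𝟙 _))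
    simp only [← starHomEquiv_map] at e
    exact (A.compose_congr (happ _) rfl _).trans (e.trans (happ _).symm)
  · symm
    refine ((A.baseChange J).compose_congr (Category.assoc _ _ _).symm rfl _).trans
      ((A.baseChange J).ident_compose' _ _ ?_)
    refine (Category.assoc _ _ _).trans ((_ ≫= app_tgt).trans ?_)
    rw [← Category.assoc, terminal.comp_from]

/-- Global arrows of `J^* A` correspond to arrows of `A` in context `J`, and this identifies the
morphisms `J^* c ⟶ c'` with the morphisms from `c` to the transpose of `c'`. -/
theorem GenCocone.IsTranspose.existsUnique_isHom_iff {s : GenCocone D J}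
    {c' : InternalCocone (D.baseChange J)} (hs : s.IsTranspose c') (c : InternalCocone D) :
    (∃! h, s.IsHom c h) ↔ Nonempty (Unique (c.baseChange J ⟶ c')) := by
  have hs' : starHomEquiv c'.legs.app =
      s.leg ((Over.star J).obj 𝔻.obj).hom (starHomEquiv (𝟙 _)) := by
    rw [← hs.leg, Category.id_comp]
  have h1 (f : InternalCocone.Hom (c.baseChange J) c') : s.IsHom c (globalStarEquiv f.hom) := by
    refine ⟨?_, ?_, fun {X} j d => ?_⟩
    · rw [← globalStarEquiv_comp_map]
      exact (congrArg globalStarEquiv f.hom_src).trans (globalStarEquiv_map_terminal _)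
    · rw [← globalStarEquiv_comp_map, ← hs.vertex]
      exact congrArg globalStarEquiv f.hom_tgt
    · have e := congrArg starHomEquiv ((starHomEquiv.symm d : Over.mk j ⟶ _) ≫= f.w)
      rw [hs.leg, Equiv.apply_symm_apply, PreInternalCategory.comp_compose,
        starHomEquiv_compose] at e
      refine Eq.trans (A.compose_congr ?_ ?_ _) e
      · rw [← Category.assoc, terminal.comp_from, starHomEquiv_terminal_comp]
        rfl
      · have e1 := starHomEquiv_comp_map (starHomEquiv.symm d : Over.mk j ⟶ _) c.legs.app
        rw [Equiv.apply_symm_apply] at e1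
        exact e1.symm
  have h2 (h : J ⟶ A.arr) (hh : s.IsHom c h) :
      ∃ f : InternalCocone.Hom (c.baseChange J) c', globalStarEquiv f.hom = h := by
    refine ⟨⟨globalStarEquiv.symm h, ?_, ?_, ?_⟩, Equiv.apply_symm_apply _ _⟩
    · apply globalStarEquiv.injective
      rw [globalStarEquiv_comp_map, Equiv.apply_symm_apply, hh.src]
      exact (globalStarEquiv_map_terminal _).symm
    · apply globalStarEquiv.injective
      rw [globalStarEquiv_comp_map, Equiv.apply_symm_apply, hs.vertex, hh.tgt]
    · apply starHomEquiv.injective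
      rw [starHomEquiv_compose, hs', ← hh.fac]
      refine A.compose_congr ?_ (starHomEquiv_map _) _
      rw [starHomEquiv_terminal_comp, Equiv.apply_symm_apply]
  constructor
  · rintro ⟨h, hh, hu⟩
    obtain ⟨f, hf⟩ := h2 h hh
    refine ⟨⟨⟨f⟩, fun g => InternalCocone.Hom.ext (globalStarEquiv.injective ?_)⟩⟩
    exact (hu _ (h1 g)).trans hf.symm
  · rintro ⟨⟨⟨f⟩, hu⟩⟩
    refine ⟨_, h1 f, fun h hh => ?_⟩
    obtain ⟨g, rfl⟩ := h2 h hh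
    exact congrArg (fun k : InternalCocone.Hom (c.baseChange J) c' => globalStarEquiv k.hom) (hu g)

/-- Universality of a cocone, expressed with cocones in context instead of base change. -/
theorem InternalCocone.isUniversal_iff (c : InternalCocone D) :
    c.IsUniversal ↔ ∀ (J : C) (s : GenCocone D J), ∃! h, s.IsHom c h := by
  constructor
  · intro hc J s
    obtain ⟨c', hc'⟩ := s.exists_isTranspose
    obtain ⟨hJ⟩ := hc J
    exact (hc'.existsUnique_isHom_iff c).2 ⟨⟨⟨hJ.to c'⟩, fun f => hJ.hom_ext _ _⟩⟩
  · intro hc J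
    have (c' : InternalCocone (D.baseChange J)) : Nonempty (Unique (c.baseChange J ⟶ c')) := by
      obtain ⟨s, hs⟩ := c'.exists_isTranspose
      exact (hs.existsUnique_isHom_iff c).1 (hc J s)
    have (c' : InternalCocone (D.baseChange J)) := (this c').some
    exact ⟨IsInitial.ofUnique _⟩

end BaseChange

/-! ### Opposite internal categories -/

section Opposite

variable {C : Type u} [Category.{v} C] [HasFiniteLimits C]

/-- The opposite of the data of an internal category. -/
noncomputable abbrev PreInternalCategory.op (A : PreInternalCategory C) :
    PreInternalCategory C where
  obj := A.obj
  arr := A.arr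
  src := A.tgt
  tgt := A.src
  ident := A.ident
  comp := A.compose (pullback.snd _ _) (pullback.fst _ _) pullback.condition.symm
  ident_src := A.ident_tgt
  ident_tgt := A.ident_src
  comp_src := A.compose_tgt _ _ _
  comp_tgt := A.compose_src _ _ _

theorem PreInternalCategory.op_compose (A : PreInternalCategory C) {X : C} (g f : X ⟶ A.arr)
    (h : g ≫ A.tgt = f ≫ A.src) : A.op.compose g f h = A.compose f g h.symm := by
  have e : A.op.compose g f h = pullback.lift g f h ≫
    A.compose (pullback.snd _ _) (pullback.fst _ _) pullback.condition.symm := rfl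
  rw [e, A.comp_compose]
  exact A.compose_congr (pullback.lift_snd _ _ _) (pullback.lift_fst _ _ _) _

/-- The opposite of an internal category. -/
noncomputable abbrev InternalCategory.op (A : InternalCategory C) : InternalCategory C where
  toPreInternalCategory := A.toPreInternalCategory.op
  assoc h g f hg gf := by
    simp only [PreInternalCategory.op_compose]
    exact (A.assoc _ _ _ _ _).symm
  comp_ident f := (A.op_compose _ _ _).trans (A.ident_comp f)
  ident_comp f := (A.op_compose _ _ _).trans (A.comp_ident f)

theorem InternalCategory.op_op (A : InternalCategory C) : A.op.op = A := by
  have h : A.toPreInternalCategory.op.op = A.toPreInternalCategory := by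
    have e : A.toPreInternalCategory.op.op.comp = A.comp := by
      refine (A.toPreInternalCategory.op_compose _ _ _).trans ?_
      have e1 : pullback.lift (pullback.fst A.src A.tgt) (pullback.snd A.src A.tgt)
          pullback.condition = 𝟙 _ := by
        apply pullback.hom_ext <;> simp
      rw [PreInternalCategory.compose, e1, Category.id_comp]
    obtain ⟨⟨⟩, _, _, _⟩ := A
    simpa using e
  obtain ⟨A', _, _, _⟩ := A
  simpa [InternalCategory.op] using h

variable {𝔻 A : InternalCategory C}

/-- The opposite of an internal functor. -/
noncomputable def InternalFunctor.op (D : InternalFunctor 𝔻 A) :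
    InternalFunctor 𝔻.op A.op where
  onObj := D.onObj
  onArr := D.onArr
  map_src := D.map_tgt
  map_tgt := D.map_src
  map_ident := D.map_ident
  map_comp g f h := by
    rw [PreInternalCategory.op_compose, PreInternalCategory.op_compose]
    exact D.map_comp f g h.symm

/-- A diagram has a limit if the opposite diagram has a colimit. -/
theorem InternalFunctor.hasLimit_of_op (D : InternalFunctor 𝔻 A) (h : D.op.HasColimit) :
    D.HasLimit := by
  obtain ⟨c, hc⟩ := h
  rw [c.isUniversal_iff] at hc
  let c' : InternalCone D :=
    { vertex := c.vertex
      legs :=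
        { app := c.legs.app
          app_src := c.legs.app_tgt
          app_tgt := c.legs.app_src
          naturality :=
            (A.op_compose _ _ _).symm.trans (c.legs.naturality.symm.trans (A.op_compose _ _ _)) } }
  refine ⟨c', c'.isUniversal_iff.2 fun J s => ?_⟩
  let s' : GenCocone D.op J :=
    { vertex := s.vertex
      leg := s.leg
      comp_leg := s.comp_leg
      leg_src := s.leg_tgt
      leg_tgt := s.leg_src
      naturality := fun j f => (A.op_compose _ _ _).trans (s.naturality j f) }
  have key (h : J ⟶ A.arr) : s'.IsHom c h ↔ s.IsHom c' h :=
    ⟨fun hh => ⟨hh.tgt, hh.src, fun j d => (A.op_compose _ _ _).symm.trans (hh.fac j d)⟩,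
      fun hh => ⟨hh.tgt, hh.src, fun j d => (A.op_compose _ _ _).trans (hh.fac j d)⟩⟩
  simpa only [key] using hc J s'

end Opposite

/-! ### Limits and colimits in a cartesian closed category -/

section CartesianClosed

variable {C : Type u} [Category.{v} C] [HasFiniteLimits C] [CartesianMonoidalCategory C]
  [MonoidalClosed C] {A : InternalCategory C}

/-- In a cartesian closed category, an internal category with all limits has all colimits. -/
theorem InternalFunctor.hasColimit_of_forall_hasLimit
    (h : ∀ (𝔻 : InternalCategory C) (D : InternalFunctor 𝔻 A), D.HasLimit)
    {𝔻 : InternalCategory C} (D : InternalFunctor 𝔻 A) : D.HasColimit := by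
  obtain ⟨K⟩ := CoconeClassifier.nonempty D
  obtain ⟨L, hL⟩ := h _ K.forget
  obtain ⟨c, hc⟩ := exists_universal_genCocone (L.isUniversal_iff.1 hL)
  exact ⟨c, c.isUniversal_iff.2 hc⟩

/-- In a cartesian closed category, an internal category with all colimits has all limits. -/
theorem InternalFunctor.hasLimit_of_forall_hasColimit
    (h : ∀ (𝔻 : InternalCategory C) (D : InternalFunctor 𝔻 A), D.HasColimit)
    {𝔻 : InternalCategory C} (D : InternalFunctor 𝔻 A) : D.HasLimit := by
  rw [← A.op_op] at h
  exact D.hasLimit_of_op (hasColimit_of_forall_hasLimit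
    (fun 𝔻' D' => D'.hasLimit_of_op (h 𝔻'.op D'.op)) D.op)

end CartesianClosed

theorem mainTheorem1 {E : Type u} [Category.{v} E] [HasFiniteLimits E] [LocallyCartesianClosed E]
    (A : InternalCategory E) : A.IsComplete ↔ A.IsCocomplete := by
  constructor
  · intro h I 𝔻 D
    let _ := Over.cartesianMonoidalCategory I
    let _ := (LocallyCartesianClosed.closed_over I).some
    exact InternalFunctor.hasColimit_of_forall_hasLimit (h I) D
  · intro h I 𝔻 D
    let _ := Over.cartesianMonoidalCategory I
    let _ := (LocallyCartesianClosed.closed_over I).some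
    exact InternalFunctor.hasLimit_of_forall_hasColimit (h I) D
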